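/- Let $n\ge 1$, let $\Omega\subset\mathbb R^n$ be a bounded domain with smooth boundary and unit outer normal $\nu$, let $d_1,d_2,d_3>0$, $k>0$, and let $\lambda_1$ be the smallest positive eigenvalue of $-\Delta$ on $\Omega$ with homogeneous Neumann boundary conditions. Let $u_2,u_3$ be real functions of $(t,x)\in(0,\infty)\times\Omega$ with $$\frac{0.52+100u_3^2+20u_3}{1.6+2k}<d_3\lambda_1\qquad\text{on }(0,\infty)\times\Omega .$$ Consider, for any real function $v_1$ of $(t,x)$ (which may depend on the solution $E$), the system $$\frac{\partial E}{\partial t}-D\Delta E=AE\ \text{ in }(0,\infty)\times\Omega,\qquad \frac{\partial e_i}{\partial\nu}=0\ \text{ on }(0,\infty)\times\partial\Omega\quad(i=1,2,3),$$ for $E=(e_1,e_2,e_3)^T$, where $D=\mathrm{diag}(d_1,d_2,d_3)$ and $$A=\begin{pmatrix}-0.4&1+10u_3&5u_2\\-1-10u_3&-0.4&5v_1\\-5u_2&-5v_1&-k\end{pmatrix}.$$ Solutions are classical and global in time: each $e_i$ is continuous on $[0,\infty)\times\overline\Omega$, once continuously differentiable in $t$ and twice in $x$ on $(0,\infty)\times\Omega$,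 and $\nabla e_i$ extends continuously to $(0,\infty)\times\overline\Omega$. Then the zero solution is globally asymptotically stable in $L^2(\Omega;\mathbb R^3)$: for every $\varepsilon>0$ there is $\delta>0$ such that every solution $E$ with $\|E(0)\|_{L^2}<\delta$ satisfies $\|E(t)\|_{L^2}<\varepsilon$ for all $t\ge0$, and $\|E(t)\|_{L^2}\to0$ as $t\to\infty$ for every solution $E$. The convergence is exponential: there are constants $C,c>0$ with $\|E(t)\|_{L^2}\le Ce^{-ct}\|E(0)\|_{L^2}$ for every solution $E$ and all $t\ge 0$. Moreover, for every solution, $V(t)=\frac12\int_\Omega(e_1^2+e_2^2+e_3^2)\,dx$ is differentiable at every $t>0$ with $$\frac{dV}{dt}=-\sum_{i=1}^3d_i\int_\Omega|\nabla e_i|^2dx-0.4\int_\Omega e_1^2dx-0.4\int_\Omega e_2^2dx-k\int_\Omega e_3^2dx .$$ -/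

import Mathlib

open Set Filter Topology MeasureTheory
open scoped Gradient Laplacian ContDiff

/-- Euclidean space `ℝⁿ`. -/
abbrev Euc (n : ℕ) : Type := EuclideanSpace ℝ (Fin n)

/-- `ρ` is a smooth defining function of `Ω`: `Ω = {ρ < 0}` and `∇ρ ≠ 0` on the level set
`{ρ = 0}` (which is then the boundary of `Ω`). -/
structure IsDefiningFunction {n : ℕ} (Ω : Set (Euc n)) (ρ : Euc n → ℝ) : Prop where
  smooth : ContDiff ℝ ∞ ρ
  eq_sublevel : Ω = {x | ρ x < 0}
  regular : ∀ x, ρ x = 0 → ∇ ρ x ≠ 0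

/-- A bounded domain (non-empty connected open set) of `ℝⁿ` with smooth boundary. -/
structure IsSmoothBoundedDomain {n : ℕ} (Ω : Set (Euc n)) : Prop where
  isOpen : IsOpen Ω
  connected : IsConnected Ω
  bounded : Bornology.IsBounded Ω
  smooth_boundary : ∃ ρ : Euc n → ℝ, IsDefiningFunction Ω ρ

/-- `ν` is the unit outer normal to `∂Ω` at the boundary point `x`: the normalized gradient of a
defining function (any two defining functions give the same vector). -/
def IsOuterUnitNormal {n : ℕ} (Ω : Set (Euc n)) (x ν : Euc n) : Prop :=
  x ∈ frontier Ω ∧ ∃ ρ : Euc n → ℝ, IsDefiningFunction Ω ρ ∧ ν = ‖∇ ρ x‖⁻¹ • ∇ ρ x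

/-- `G` is the continuous extension to the closure of `Ω` of the gradient of `w`, and
`∂w/∂ν = G · ν = 0` on `∂Ω`. -/
structure HasNeumannGradient {n : ℕ} (Ω : Set (Euc n)) (w : Euc n → ℝ) (G : Euc n → Euc n) :
    Prop where
  continuousOn : ContinuousOn G (closure Ω)
  eq_gradient : ∀ x ∈ Ω, G x = ∇ w x
  neumann : ∀ x ν, IsOuterUnitNormal Ω x ν → inner ℝ (G x) ν = 0

/-- `lam` is an eigenvalue of `-Δ` on `Ω` with homogeneous Neumann boundary conditions. -/
def IsNeumannEigenvalue {n : ℕ} (Ω : Set (Euc n)) (lam : ℝ) : Prop :=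
  ∃ Φ : Euc n → ℝ, ContinuousOn Φ (closure Ω) ∧ ContDiffOn ℝ 2 Φ Ω ∧
    (∃ G, HasNeumannGradient Ω Φ G) ∧ (∀ x ∈ Ω, -(Δ Φ x) = lam * Φ x) ∧ (∃ x ∈ Ω, Φ x ≠ 0)

/-- The first non-zero eigenvalue `λ₁` of `-Δ` on `Ω` with Neumann boundary conditions
(the spectrum is discrete, so that the infimum is a minimum). -/
noncomputable def firstNeumannEigenvalue {n : ℕ} (Ω : Set (Euc n)) : ℝ :=
  sInf {lam : ℝ | 0 < lam ∧ IsNeumannEigenvalue Ω lam}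

/-- The matrix `A` of the error system, for given values of `u₂, u₃, v₁`. -/
noncomputable def errorMatrix (k u₂ u₃ v₁ : ℝ) : Matrix (Fin 3) (Fin 3) ℝ :=
  !![-0.4, 1 + 10 * u₃, 5 * u₂;
     -1 - 10 * u₃, -0.4, 5 * v₁;
     -5 * u₂, -5 * v₁, -k]

/-- The regularity of a component of a classical solution, together with the Neumann condition:
`w` is continuous on `[0,∞) × Ω̄`, is of class `C^{1,2}` on `(0,∞) × Ω`, its spatial gradient
extends continuously to `(0,∞) × Ω̄`, and `∂w/∂ν = 0` on `(0,∞) × ∂Ω`. -/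
structure IsClassicalNeumann {n : ℕ} (Ω : Set (Euc n)) (w : ℝ → Euc n → ℝ) : Prop where
  continuousOn : ContinuousOn (fun p : ℝ × Euc n => w p.1 p.2) (Ici 0 ×ˢ closure Ω)
  differentiableAt_time : ∀ t > 0, ∀ x ∈ Ω, DifferentiableAt ℝ (fun s => w s x) t
  continuousOn_time_deriv :
    ContinuousOn (fun p : ℝ × Euc n => deriv (fun s => w s p.2) p.1) (Ioi 0 ×ˢ Ω)
  contDiffOn_space : ∀ t > 0, ContDiffOn ℝ 2 (w t) Ω
  continuousOn_space_deriv :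
    ContinuousOn (fun p : ℝ × Euc n => iteratedFDeriv ℝ 2 (w p.1) p.2) (Ioi 0 ×ˢ Ω)
  neumann : ∃ G : ℝ → Euc n → Euc n,
    ContinuousOn (fun p : ℝ × Euc n => G p.1 p.2) (Ioi 0 ×ˢ closure Ω) ∧
      ∀ t > 0, HasNeumannGradient Ω (w t) (G t)

/-- `E` is a classical solution of `dE/dt - DΔE = AE` on `(0,∞) × Ω`, `D = diag(d₁, d₂, d₃)`, with
homogeneous Neumann boundary conditions. The coefficients are functions of `(t, x)`. -/
structure IsErrorSolution {n : ℕ} (Ω : Set (Euc n)) (d : Fin 3 → ℝ) (k : ℝ)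
    (u₂ u₃ v₁ : ℝ → Euc n → ℝ) (E : ℝ → Euc n → Fin 3 → ℝ) : Prop where
  regular : ∀ i, IsClassicalNeumann Ω (fun t x => E t x i)
  equation : ∀ t > 0, ∀ x ∈ Ω, ∀ i,
    deriv (fun s => E s x i) t - d i * Δ (fun y => E t y i) x
      = (errorMatrix k (u₂ t x) (u₃ t x) (v₁ t x)).mulVec (E t x) i

/-- The set of all solutions of the error system when `u₂, u₃` are given. The coefficient `v₁` is
left free, since in the error system of a master-slave pair `v₁ = u₁ + e₁` varies with `E`. -/
def errorSolutions {n : ℕ} (Ω : Set (Euc n)) (d : Fin 3 → ℝ) (k : ℝ) (u₂ u₃ : ℝ → Euc n → ℝ) :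
    Set (ℝ → Euc n → Fin 3 → ℝ) :=
  {E | ∃ v₁ : ℝ → Euc n → ℝ, IsErrorSolution Ω d k u₂ u₃ v₁ E}

/-- The functional `½ ∫_Ω (e₁² + e₂² + e₃²) dx`. -/
noncomputable def energy {n : ℕ} (Ω : Set (Euc n)) (w : Euc n → Fin 3 → ℝ) : ℝ :=
  1 / 2 * ∫ x in Ω, (w x 0 ^ 2 + w x 1 ^ 2 + w x 2 ^ 2)

/-- The norm of `L²(Ω; ℝ³)` (of functions that are continuous on the closure of `Ω`). -/
noncomputable def l2Norm {n : ℕ} (Ω : Set (Euc n)) (w : Euc n → Fin 3 → ℝ) : ℝ :=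
  Real.sqrt (∫ x in Ω, (w x 0 ^ 2 + w x 1 ^ 2 + w x 2 ^ 2))

/-- The zero solution is globally asymptotically stable in `L²(Ω; ℝ³)` among the solutions `S`:
it is a solution, it is stable in the sense of Lyapunov, and it attracts every solution. -/
structure ZeroGloballyAsymptoticallyStable {n : ℕ} (Ω : Set (Euc n))
    (S : Set (ℝ → Euc n → Fin 3 → ℝ)) : Prop where
  zero_mem : (fun _ _ _ => 0) ∈ S
  stable : ∀ ε > 0, ∃ δ > 0, ∀ E ∈ S, l2Norm Ω (E 0) < δ → ∀ t ≥ 0, l2Norm Ω (E t) < ε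
  attractive : ∀ E ∈ S, Tendsto (fun t => l2Norm Ω (E t)) atTop (𝓝 0)

/-! ### Green's identity with compactly supported test functions. -/

section CompactSupport

variable {n : ℕ} {Ω : Set (Euc n)}

/-! The off-diagonal part of the error matrix is skew-symmetric, so testing the system with `E`
leaves only the damping `-0.4, -0.4, -k`, whatever `u₂`, `u₃`, `v₁` are. With Green's identity and
the Neumann condition this is the energy identity. Diffusion only helps, and Grönwall's argument
gives decay of the norm at rate `min 0.4 k`, hence stability and attraction.

The work lies in the energy identity (`IsErrorSolution.hasDerivAt_energy`). Time derivatives and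
Laplacians are controlled only inside `Ω`, so neither differentiation under the integral nor the
divergence theorem applies on all of `Ω`. Everything is first multiplied by a cutoff `χ_m` built
from a defining function `ρ`. Green's identity then produces a layer term with weight `a_m`, where
`∇χ_m = -a_m ∇ρ`. The masses `∫ a_m ‖∇ρ‖²` are bounded in `m`, and the other factor `w ⟨∇ρ, G⟩`
vanishes on the boundary, so the layer term tends to zero uniformly on compact time intervals in
`(0,∞)`. The derivatives of the cut-off energies thus converge locally uniformly, and the limit
energy is differentiable with the expected derivative. -/

theorem continuous_mul_of_tsupport_subset (hΩ : IsOpen Ω) {φ h : Euc n → ℝ}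
    (hφ : ContinuousOn φ Ω) (hs : tsupport φ ⊆ Ω) (hh : ContinuousOn h Ω) :
    Continuous (fun x => φ x * h x) := by
  refine continuous_of_tsupport fun x hx => ?_
  have hx' : x ∈ Ω := hs (tsupport_mul_subset_left hx)
  exact (hφ.continuousAt (hΩ.mem_nhds hx')).mul (hh.continuousAt (hΩ.mem_nhds hx'))

theorem integrable_mul_of_tsupport_subset (hΩ : IsOpen Ω) {φ h : Euc n → ℝ}
    (hφ : ContinuousOn φ Ω) (hc : HasCompactSupport φ) (hs : tsupport φ ⊆ Ω)
    (hh : ContinuousOn h Ω) : Integrable (fun x => φ x * h x) :=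
  (continuous_mul_of_tsupport_subset hΩ hφ hs hh).integrable_of_hasCompactSupport hc.mul_right

theorem differentiableAt_of_tsupport_subset (hΩ : IsOpen Ω) {φ : Euc n → ℝ}
    (hφ : ContDiffOn ℝ 1 φ Ω) (hs : tsupport φ ⊆ Ω) (x : Euc n) : DifferentiableAt ℝ φ x := by
  by_cases hx : x ∈ tsupport φ
  · exact (hφ.contDiffAt (hΩ.mem_nhds (hs hx))).differentiableAt one_ne_zero
  · exact (notMem_tsupport_iff_eventuallyEq.1 hx).differentiableAt_iff.2
      (differentiableAt_const _)

/-- Green's first identity for a compactly supported test function. -/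
theorem setIntegral_mul_laplacian_of_tsupport_subset (hΩ : IsOpen Ω) {φ w : Euc n → ℝ}
    (hφ : ContDiffOn ℝ 1 φ Ω) (hc : HasCompactSupport φ) (hs : tsupport φ ⊆ Ω)
    (hw : ContDiffOn ℝ 2 w Ω) :
    ∫ x in Ω, φ x * Δ w x = -∫ x in Ω, inner ℝ (∇ φ x) (∇ w x) := by
  have hzero : ∀ x ∉ Ω, φ x = 0 ∧ ∇ φ x = 0 := by
    intro x hx
    have h1 : φ =ᶠ[𝓝 x] fun _ => 0 :=
      notMem_tsupport_iff_eventuallyEq.1 fun h' => hx (hs h')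
    exact ⟨h1.eq_of_nhds, by rw [h1.gradient_eq, gradient_fun_const]⟩
  -- Both integrands vanish off `Ω`, so integration by parts can be done on the whole space, one
  -- coordinate at a time.
  rw [setIntegral_eq_integral_of_forall_compl_eq_zero (fun x hx => by simp [(hzero x hx).1]),
    setIntegral_eq_integral_of_forall_compl_eq_zero (fun x hx => by simp [(hzero x hx).2])]
  set b := EuclideanSpace.basisFun (Fin n) ℝ with hb
  have hw1 : ContDiffOn ℝ 1 (fderiv ℝ w) Ω := hw.fderiv_of_isOpen hΩ (by norm_num)
  have hφd := differentiableAt_of_tsupport_subset hΩ hφ hs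
  have hφ' : ContinuousOn (fderiv ℝ φ) Ω := hφ.continuousOn_fderiv_of_isOpen hΩ (by norm_num)
  have hwj : ∀ j, ContDiffOn ℝ 1 (fun x => fderiv ℝ w x (b j)) Ω := fun j =>
    hw1.clm_apply contDiffOn_const
  have hwjj : ∀ j, ContinuousOn (fun x => fderiv ℝ (fun y => fderiv ℝ w y (b j)) x (b j)) Ω :=
    fun j => ((hwj j).continuousOn_fderiv_of_isOpen hΩ (by norm_num)).clm_apply continuousOn_const
  have hΔ : ∀ x ∈ Ω, Δ w x = ∑ j, fderiv ℝ (fun y => fderiv ℝ w y (b j)) x (b j) := by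
    intro x hx
    rw [InnerProductSpace.laplacian_eq_iteratedFDeriv_orthonormalBasis w b]
    refine Finset.sum_congr rfl fun j _ => ?_
    rw [iteratedFDeriv_two_apply]
    have hd : DifferentiableAt ℝ (fderiv ℝ w) x :=
      (hw1.contDiffAt (hΩ.mem_nhds hx)).differentiableAt one_ne_zero
    rw [fderiv_clm_apply hd (differentiableAt_const _)]
    simp
  have hφj : ∀ j, tsupport (fun x => fderiv ℝ φ x (b j)) ⊆ tsupport φ := fun j => by
    refine closure_minimal (fun x hx => ?_) (isClosed_tsupport _)
    by_contra h
    apply hx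
    have h1 : φ =ᶠ[𝓝 x] fun _ => 0 := notMem_tsupport_iff_eventuallyEq.1 h
    simp [h1.fderiv_eq]
  have hcj : ∀ j, HasCompactSupport (fun x => fderiv ℝ φ x (b j)) := fun j =>
    hc.of_isClosed_subset (isClosed_tsupport _) (hφj j)
  have hint1 : ∀ j, Integrable (fun x => fderiv ℝ φ x (b j) * fderiv ℝ w x (b j)) := fun j =>
    integrable_mul_of_tsupport_subset hΩ (hφ'.clm_apply continuousOn_const) (hcj j)
      ((hφj j).trans hs) (hwj j).continuousOn
  have hint2 : ∀ j, Integrable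
      (fun x => φ x * fderiv ℝ (fun y => fderiv ℝ w y (b j)) x (b j)) := fun j =>
    integrable_mul_of_tsupport_subset hΩ hφ.continuousOn hc hs (hwjj j)
  have e1 : ∀ x, φ x * Δ w x = ∑ j, φ x * fderiv ℝ (fun y => fderiv ℝ w y (b j)) x (b j) := by
    intro x
    by_cases hx : x ∈ Ω
    · rw [hΔ x hx, Finset.mul_sum]
    · simp [(hzero x hx).1]
  have e2 : ∀ x, inner ℝ (∇ φ x) (∇ w x) = ∑ j, fderiv ℝ φ x (b j) * fderiv ℝ w x (b j) := by
    intro x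
    rw [← b.sum_inner_mul_inner]
    refine Finset.sum_congr rfl fun j _ => ?_
    rw [inner_gradient_left, inner_gradient_right]
    simp
  simp_rw [e1, e2]
  rw [integral_finsetSum _ fun j _ => hint2 j, integral_finsetSum _ fun j _ => hint1 j,
    ← Finset.sum_neg_distrib]
  refine Finset.sum_congr rfl fun j _ => ?_
  refine integral_mul_fderiv_eq_neg_fderiv_mul_of_integrable (hint1 j) (hint2 j)
    (integrable_mul_of_tsupport_subset hΩ hφ.continuousOn hc hs (hwj j).continuousOn)
    (fun x _ => hφd x) fun x hx => ?_
  exact ((hwj j).contDiffAt (hΩ.mem_nhds (hs hx))).differentiableAt one_ne_zero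

end CompactSupport

/-! ### Cutoffs built from a defining function. -/

section Cutoff

variable {n : ℕ} {Ω : Set (Euc n)} {ρ : Euc n → ℝ}

/-- A smooth cut-off function that vanishes where `-1 / (m + 1) ≤ ρ` and equals `1` where
`ρ ≤ -2 / (m + 1)`. -/
noncomputable def sublevelCutoff (ρ : Euc n → ℝ) (m : ℕ) (x : Euc n) : ℝ :=
  Real.smoothTransition (-((m + 1 : ℝ) * ρ x) - 1)

/-- The factor `a` in `∇ (sublevelCutoff ρ m) = -a • ∇ ρ`. -/
noncomputable def sublevelCutoffSlope (ρ : Euc n → ℝ) (m : ℕ) (x : Euc n) : ℝ :=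
  (m + 1 : ℝ) * deriv Real.smoothTransition (-((m + 1 : ℝ) * ρ x) - 1)

theorem sublevelCutoff_nonneg (m : ℕ) (x : Euc n) : 0 ≤ sublevelCutoff ρ m x :=
  Real.smoothTransition.nonneg _

theorem sublevelCutoff_le_one (m : ℕ) (x : Euc n) : sublevelCutoff ρ m x ≤ 1 :=
  Real.smoothTransition.le_one _

theorem sublevelCutoffSlope_nonneg (m : ℕ) (x : Euc n) : 0 ≤ sublevelCutoffSlope ρ m x :=
  mul_nonneg (by positivity) (Real.smoothTransition.monotone.deriv_nonneg)

theorem deriv_smoothTransition_eq_zero {s : ℝ} (hs : 1 < s) :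
    deriv Real.smoothTransition s = 0 := by
  have : Real.smoothTransition =ᶠ[𝓝 s] fun _ => 1 := by
    filter_upwards [lt_mem_nhds hs] with y hy
    exact Real.smoothTransition.one_of_one_le hy.le
  rw [this.deriv_eq]; simp

theorem sublevelCutoffSlope_eq_zero {m : ℕ} {x : Euc n} (h : (m + 1 : ℝ) * ρ x < -2) :
    sublevelCutoffSlope ρ m x = 0 := by
  unfold sublevelCutoffSlope
  rw [deriv_smoothTransition_eq_zero (by linarith), mul_zero]

theorem contDiff_sublevelCutoff (hρ : ContDiff ℝ ∞ ρ) (m : ℕ) :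
    ContDiff ℝ 1 (sublevelCutoff ρ m) := by
  have h1 : ContDiff ℝ 1 ρ := hρ.of_le (by exact_mod_cast le_top)
  have h2 : ContDiff ℝ 1 Real.smoothTransition := Real.smoothTransition.contDiff (n := 1)
  exact h2.comp (((contDiff_const.mul h1).neg).sub contDiff_const)

theorem continuous_sublevelCutoffSlope (hρ : Continuous ρ) (m : ℕ) :
    Continuous (sublevelCutoffSlope ρ m) := by
  have h2 : ContDiff ℝ 1 Real.smoothTransition := Real.smoothTransition.contDiff (n := 1)
  have h3 := h2.continuous_deriv le_rfl
  unfold sublevelCutoffSlope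
  fun_prop

theorem gradient_sublevelCutoff (hρ : Differentiable ℝ ρ) (m : ℕ) (x : Euc n) :
    ∇ (sublevelCutoff ρ m) x = -(sublevelCutoffSlope ρ m x) • ∇ ρ x := by
  have h2 : ContDiff ℝ 1 Real.smoothTransition := Real.smoothTransition.contDiff (n := 1)
  have h3 := (h2.differentiable one_ne_zero (-((m + 1 : ℝ) * ρ x) - 1)).hasDerivAt
  have h4 : HasFDerivAt (fun y => -((m + 1 : ℝ) * ρ y) - 1) (-((m + 1 : ℝ) • fderiv ℝ ρ x)) x :=
    (((hρ x).hasFDerivAt.const_mul _).neg).sub_const _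
  have h5 := h3.comp_hasFDerivAt x h4
  have h6 : HasGradientAt (sublevelCutoff ρ m) (-(sublevelCutoffSlope ρ m x) • ∇ ρ x) x := by
    rw [hasGradientAt_iff_hasFDerivAt]
    refine h5.congr_fderiv ?_
    ext y
    simp [sublevelCutoffSlope]
    ring
  exact h6.gradient

theorem tsupport_sublevelCutoff_subset (hρ : Continuous ρ) (m : ℕ) :
    tsupport (sublevelCutoff ρ m) ⊆ {x | (m + 1 : ℝ) * ρ x ≤ -1} := by
  refine closure_minimal (fun x hx => ?_)
    (isClosed_le (continuous_const.mul hρ) continuous_const)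
  by_contra h
  simp only [mem_ofPred_eq, not_le] at h
  exact hx (Real.smoothTransition.zero_of_nonpos (by linarith))

namespace IsDefiningFunction

theorem tsupport_sublevelCutoff_subset (h : IsDefiningFunction Ω ρ) (m : ℕ) :
    tsupport (sublevelCutoff ρ m) ⊆ Ω := by
  intro x hx
  have h1 := _root_.tsupport_sublevelCutoff_subset h.smooth.continuous m hx
  rw [h.eq_sublevel]
  simp only [mem_ofPred_eq] at h1 ⊢
  by_contra h2
  have : 0 ≤ (m + 1 : ℝ) * ρ x := mul_nonneg (by positivity) (not_lt.1 h2)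
  linarith

theorem hasCompactSupport_sublevelCutoff (h : IsDefiningFunction Ω ρ)
    (hb : Bornology.IsBounded Ω) (m : ℕ) : HasCompactSupport (sublevelCutoff ρ m) :=
  Metric.isCompact_of_isClosed_isBounded (isClosed_tsupport _)
    (hb.subset (h.tsupport_sublevelCutoff_subset m))

theorem tendsto_sublevelCutoff (h : IsDefiningFunction Ω ρ) {x : Euc n} (hx : x ∈ Ω) :
    Tendsto (fun m => sublevelCutoff ρ m x) atTop (𝓝 1) := by
  rw [h.eq_sublevel] at hx
  obtain ⟨N, hN⟩ := exists_nat_gt (2 / (-ρ x))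
  refine tendsto_const_nhds.congr' ?_
  filter_upwards [eventually_ge_atTop N] with m hm
  refine (Real.smoothTransition.one_of_one_le ?_).symm
  have hpos : 0 < -ρ x := by simpa using hx
  rw [div_lt_iff₀ hpos] at hN
  have : (N : ℝ) ≤ m := by exact_mod_cast hm
  nlinarith

theorem eq_zero_of_mem_frontier (h : IsDefiningFunction Ω ρ) {x : Euc n} (hx : x ∈ closure Ω)
    (hx' : x ∉ Ω) : ρ x = 0 := by
  have h1 : closure Ω ⊆ {x | ρ x ≤ 0} := closure_minimal
    (fun y hy => by rw [h.eq_sublevel] at hy; exact le_of_lt (show ρ y < 0 from hy))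
    (isClosed_le h.smooth.continuous continuous_const)
  have h2 : ¬ ρ x < 0 := by rw [h.eq_sublevel] at hx'; exact hx'
  exact le_antisymm (h1 hx) (not_lt.1 h2)

end IsDefiningFunction

end Cutoff

/-! ### Uniform limits of cut-off integrals and of boundary-layer integrals. -/

section BoundaryLayer

variable {n : ℕ} {Ω : Set (Euc n)} {ρ : Euc n → ℝ}

theorem ContDiffOn.continuousOn_laplacian (hΩ : IsOpen Ω) {w : Euc n → ℝ}
    (hw : ContDiffOn ℝ 2 w Ω) : ContinuousOn (Δ w) Ω := by
  rw [InnerProductSpace.laplacian_eq_iteratedFDeriv_stdOrthonormalBasis]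
  refine continuousOn_finsetSum _ fun j _ => ?_
  have h1 : ContinuousOn (iteratedFDeriv ℝ 2 w) Ω :=
    (hw.continuousOn_iteratedFDerivWithin (m := 2) le_rfl hΩ.uniqueDiffOn).congr
      fun x hx => (iteratedFDerivWithin_of_isOpen 2 hΩ hx).symm
  exact (ContinuousMultilinearMap.apply ℝ (fun _ : Fin 2 => Euc n) ℝ _).continuous.comp_continuousOn h1

theorem integrableOn_of_continuousOn_of_bound (hΩ : IsOpen Ω) (hb : Bornology.IsBounded Ω)
    {f : Euc n → ℝ} (hf : ContinuousOn f Ω) {M : ℝ} (hM : ∀ x ∈ Ω, |f x| ≤ M) :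
    IntegrableOn f Ω :=
  have : IsFiniteMeasure (volume.restrict Ω) := ⟨by simpa using hb.measure_lt_top⟩
  Integrable.of_bound (hf.aestronglyMeasurable hΩ.measurableSet) M
    ((ae_restrict_iff' hΩ.measurableSet).2 (ae_of_all _ hM))

theorem exists_bound_on_prod_closure (hb : Bornology.IsBounded Ω) {I : Set ℝ} (hI : IsCompact I)
    {f : ℝ → Euc n → ℝ} (hf : ContinuousOn (fun p : ℝ × Euc n => f p.1 p.2) (I ×ˢ closure Ω)) :
    ∃ M, ∀ t ∈ I, ∀ x ∈ closure Ω, |f t x| ≤ M := by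
  obtain ⟨M, hM⟩ := (hI.prod hb.isCompact_closure).exists_bound_of_continuousOn hf
  exact ⟨M, fun t ht x hx => hM (t, x) ⟨ht, hx⟩⟩

theorem continuousOn_slice {X : Type*} [TopologicalSpace X] {I : Set ℝ} {K : Set (Euc n)}
    {f : ℝ → Euc n → X} (hf : ContinuousOn (fun p : ℝ × Euc n => f p.1 p.2) (I ×ˢ K))
    {t : ℝ} (ht : t ∈ I) : ContinuousOn (f t) K :=
  hf.comp (f := fun x => (t, x)) (by fun_prop) fun _ hx => ⟨ht, hx⟩

namespace IsDefiningFunction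

theorem tendsto_setIntegral_one_sub_sublevelCutoff (h : IsDefiningFunction Ω ρ) (hΩ : IsOpen Ω)
    (hb : Bornology.IsBounded Ω) :
    Tendsto (fun m => ∫ x in Ω, (1 - sublevelCutoff ρ m x)) atTop (𝓝 0) := by
  have hfin : volume Ω ≠ ⊤ := hb.measure_lt_top.ne
  have h0 : (0 : ℝ) = ∫ _ in Ω, (0 : ℝ) := by simp
  rw [h0]
  refine tendsto_integral_of_dominated_convergence (fun _ => (1 : ℝ))
    (fun m => (continuous_const.sub
      (contDiff_sublevelCutoff h.smooth m).continuous).aestronglyMeasurable)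
    (integrableOn_const hfin) (fun m => ae_of_all _ fun x => ?_) ?_
  · have h1 := sublevelCutoff_nonneg (ρ := ρ) m x
    have h2 := sublevelCutoff_le_one (ρ := ρ) m x
    rw [Real.norm_eq_abs, abs_le]
    constructor <;> linarith
  · refine (ae_restrict_iff' hΩ.measurableSet).2 (ae_of_all _ fun x hx => ?_)
    simpa using (h.tendsto_sublevelCutoff hx).const_sub 1

/-- The error is at most `|M| ∫ (1 - χ_m)`, which does not depend on `t`. -/
theorem tendstoUniformlyOn_setIntegral_sublevelCutoff_mul (h : IsDefiningFunction Ω ρ)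
    (hΩ : IsOpen Ω) (hb : Bornology.IsBounded Ω) {I : Set ℝ} {f : ℝ → Euc n → ℝ}
    (hf : ∀ t ∈ I, ContinuousOn (f t) Ω) {M : ℝ} (hM : ∀ t ∈ I, ∀ x ∈ Ω, |f t x| ≤ M) :
    TendstoUniformlyOn (fun m t => ∫ x in Ω, sublevelCutoff ρ m x * f t x)
      (fun t => ∫ x in Ω, f t x) atTop I := by
  rw [Metric.tendstoUniformlyOn_iff]
  intro ε hε
  have h1 := ((h.tendsto_setIntegral_one_sub_sublevelCutoff hΩ hb).const_mul |M|)
  rw [mul_zero] at h1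
  filter_upwards [h1.eventually_lt_const hε] with m hm t ht
  refine lt_of_le_of_lt ?_ hm
  have hχ := (contDiff_sublevelCutoff h.smooth m).continuous
  have hfi : IntegrableOn (f t) Ω := integrableOn_of_continuousOn_of_bound hΩ hb (hf t ht) (hM t ht)
  have hχf : IntegrableOn (fun x => sublevelCutoff ρ m x * f t x) Ω :=
    (integrable_mul_of_tsupport_subset hΩ hχ.continuousOn (h.hasCompactSupport_sublevelCutoff hb m)
      (h.tsupport_sublevelCutoff_subset m) (hf t ht)).integrableOn
  have hg : IntegrableOn (fun x => 1 - sublevelCutoff ρ m x) Ω := by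
    refine integrableOn_of_continuousOn_of_bound (M := 1) hΩ hb (by fun_prop) fun x _ => ?_
    rw [abs_le]
    have h1 := sublevelCutoff_nonneg (ρ := ρ) m x
    have h2 := sublevelCutoff_le_one (ρ := ρ) m x
    constructor <;> linarith
  rw [dist_eq_norm, ← integral_sub hfi hχf, ← integral_const_mul]
  refine norm_integral_le_of_norm_le (Integrable.const_mul hg |M|) ?_
  refine (ae_restrict_iff' hΩ.measurableSet).2 (ae_of_all _ fun x hx => ?_)
  have h2 := sublevelCutoff_le_one (ρ := ρ) m x
  have h3 : f t x - sublevelCutoff ρ m x * f t x = f t x * (1 - sublevelCutoff ρ m x) := by ring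
  rw [h3, norm_mul, Real.norm_eq_abs, Real.norm_of_nonneg (by linarith)]
  exact mul_le_mul_of_nonneg_right ((hM t ht x hx).trans (le_abs_self M)) (by linarith)

theorem integrableOn_sublevelCutoffSlope_mul (h : IsDefiningFunction Ω ρ)
    (hb : Bornology.IsBounded Ω) (m : ℕ) {f : Euc n → ℝ} (hf : ContinuousOn f (closure Ω)) :
    IntegrableOn (fun x => sublevelCutoffSlope ρ m x * f x) Ω :=
  (((continuous_sublevelCutoffSlope h.smooth.continuous m).continuousOn.mul hf).integrableOn_compact
    hb.isCompact_closure).mono_set subset_closure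

theorem continuous_gradient (h : IsDefiningFunction Ω ρ) : Continuous (∇ ρ) := by
  have h1 : Continuous (fderiv ℝ ρ) := h.smooth.continuous_fderiv (by simp)
  exact (InnerProductSpace.toDual ℝ (Euc n)).symm.continuous.comp h1

/-- The boundary layers have bounded mass. -/
theorem exists_bound_setIntegral_sublevelCutoffSlope (h : IsDefiningFunction Ω ρ) (hΩ : IsOpen Ω)
    (hb : Bornology.IsBounded Ω) :
    ∃ C, ∀ m, ∫ x in Ω, sublevelCutoffSlope ρ m x * ‖∇ ρ x‖ ^ 2 ≤ C := by
  have hρ2 : ContDiff ℝ 2 ρ := mod_cast contDiff_infty.1 h.smooth 2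
  have hΔ : Continuous (Δ ρ) := continuousOn_univ.1
    (hρ2.contDiffOn.continuousOn_laplacian isOpen_univ)
  obtain ⟨M, hM⟩ := hb.isCompact_closure.exists_bound_of_continuousOn hΔ.continuousOn
  refine ⟨M * volume.real Ω, fun m => ?_⟩
  -- Green's identity for `χ_m` and `ρ` itself turns the mass of the layer into `∫ χ_m Δρ`, bounded
  -- independently of `m`.
  have hG := setIntegral_mul_laplacian_of_tsupport_subset hΩ
    (contDiff_sublevelCutoff h.smooth m).contDiffOn (h.hasCompactSupport_sublevelCutoff hb m)
    (h.tsupport_sublevelCutoff_subset m) hρ2.contDiffOn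
  simp_rw [gradient_sublevelCutoff (hρ2.differentiable two_ne_zero), inner_smul_left,
    real_inner_self_eq_norm_sq] at hG
  simp only [map_neg, neg_mul, integral_neg, neg_neg, conj_trivial] at hG
  rw [← hG]
  refine (Real.le_norm_self _).trans (norm_setIntegral_le_of_norm_le_const hb.measure_lt_top ?_)
  intro x hx
  rw [norm_mul, Real.norm_of_nonneg (sublevelCutoff_nonneg m x)]
  have := hM x (subset_closure hx)
  have h2 := sublevelCutoff_le_one (ρ := ρ) m x
  nlinarith [norm_nonneg (Δ ρ x), sublevelCutoff_nonneg (ρ := ρ) m x]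

/-- Near the boundary `f` is small while `∇ρ` is nonzero, so `|f| ≤ δ ‖∇ρ‖²` in a thin layer,
uniformly in `t`. For large `m` the weight lives in that layer, and the integral is at most `δ`
times the bounded mass. -/
theorem tendstoUniformlyOn_setIntegral_sublevelCutoffSlope_mul (h : IsDefiningFunction Ω ρ)
    (hΩ : IsOpen Ω) (hb : Bornology.IsBounded Ω) {I : Set ℝ} (hI : IsCompact I)
    {f : ℝ → Euc n → ℝ}
    (hf : ContinuousOn (fun p : ℝ × Euc n => f p.1 p.2) (I ×ˢ closure Ω))
    (hz : ∀ t ∈ I, ∀ x ∈ closure Ω, x ∉ Ω → f t x = 0) :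
    TendstoUniformlyOn (fun m t => ∫ x in Ω, sublevelCutoffSlope ρ m x * f t x)
      (fun _ => 0) atTop I := by
  rw [Metric.tendstoUniformlyOn_iff]
  intro ε hε
  obtain ⟨C, hC⟩ := h.exists_bound_setIntegral_sublevelCutoffSlope hΩ hb
  obtain ⟨δ, hδ, hδε⟩ : ∃ δ > 0, δ * C < ε := by
    refine ⟨ε / (2 * (|C| + 1)), by positivity, ?_⟩
    rw [div_mul_eq_mul_div, div_lt_iff₀ (by positivity)]
    nlinarith [le_abs_self C, abs_nonneg C]
  have hgr := h.continuous_gradient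
  obtain ⟨c, hc, hlayer⟩ : ∃ c > 0, ∀ t ∈ I, ∀ x ∈ closure Ω, -c < ρ x →
      |f t x| ≤ δ * ‖∇ ρ x‖ ^ 2 := by
    -- `B` is the compact set where `|f| ≥ δ ‖∇ρ‖²`. It avoids the boundary, so the maximum of `ρ`
    -- over it is negative and gives the width of the layer.
    set B : Set (ℝ × Euc n) := (I ×ˢ closure Ω) ∩
      (fun p : ℝ × Euc n => |f p.1 p.2| - δ * ‖∇ ρ p.2‖ ^ 2) ⁻¹' Ici 0 with hB
    have hBc : IsCompact B := by
      refine (hI.prod hb.isCompact_closure).of_isClosed_subset ?_ inter_subset_left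
      refine ContinuousOn.preimage_isClosed_of_isClosed ?_
        (hI.prod hb.isCompact_closure).isClosed isClosed_Ici
      exact hf.abs.sub (by fun_prop)
    rcases B.eq_empty_or_nonempty with hBe | hBn
    · refine ⟨1, one_pos, fun t ht x hx _ => ?_⟩
      by_contra hlt
      have : (t, x) ∈ B := ⟨⟨ht, hx⟩, by simp only [mem_preimage, mem_Ici]; linarith⟩
      simp [hBe] at this
    · obtain ⟨p, hp, hmax⟩ := hBc.exists_isMaxOn hBn
        (h.smooth.continuous.comp continuous_snd).continuousOn
      have hpneg : ρ p.2 < 0 := by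
        by_contra hpn
        have hpΩ : p.2 ∉ Ω := by rw [h.eq_sublevel]; exact hpn
        have hp0 := h.eq_zero_of_mem_frontier hp.1.2 hpΩ
        have h1 : 0 ≤ |f p.1 p.2| - δ * ‖∇ ρ p.2‖ ^ 2 := hp.2
        rw [hz _ hp.1.1 _ hp.1.2 hpΩ, abs_zero] at h1
        have h2 : 0 < ‖∇ ρ p.2‖ := norm_pos_iff.2 (h.regular _ hp0)
        have h3 : 0 < δ * ‖∇ ρ p.2‖ ^ 2 := by positivity
        linarith
      refine ⟨-ρ p.2, by linarith, fun t ht x hx hlt => ?_⟩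
      by_contra hlt'
      have hm : (t, x) ∈ B := ⟨⟨ht, hx⟩, by simp only [mem_preimage, mem_Ici]; linarith⟩
      have : ρ x ≤ ρ p.2 := hmax hm
      linarith
  obtain ⟨N, hN⟩ := exists_nat_gt (2 / c)
  filter_upwards [eventually_ge_atTop N] with m hm t ht
  rw [dist_comm, dist_zero_right]
  refine lt_of_le_of_lt ?_ hδε
  refine le_trans ?_ (mul_le_mul_of_nonneg_left (hC m) hδ.le)
  rw [← integral_const_mul]
  refine norm_integral_le_of_norm_le
    ((h.integrableOn_sublevelCutoffSlope_mul hb m (by fun_prop)).const_mul δ) ?_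
  refine (ae_restrict_iff' hΩ.measurableSet).2 (ae_of_all _ fun x hx => ?_)
  have ha := sublevelCutoffSlope_nonneg (ρ := ρ) m x
  rw [norm_mul, Real.norm_of_nonneg ha, Real.norm_eq_abs]
  by_cases hx' : -c < ρ x
  · calc _ ≤ sublevelCutoffSlope ρ m x * (δ * ‖∇ ρ x‖ ^ 2) :=
        mul_le_mul_of_nonneg_left (hlayer t ht x (subset_closure hx) hx') ha
      _ = _ := by ring
  · rw [sublevelCutoffSlope_eq_zero, zero_mul, zero_mul, mul_zero]
    rw [div_lt_iff₀ hc] at hN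
    have : (N : ℝ) ≤ m := by exact_mod_cast hm
    nlinarith

end IsDefiningFunction

end BoundaryLayer

/-! ### Cut-off energy of a single component. -/

section Energy

variable {n : ℕ} {Ω : Set (Euc n)} {ρ : Euc n → ℝ} {w : ℝ → Euc n → ℝ}

theorem TendstoUniformlyOn.const_mul_real {ι α : Type*} {l : Filter ι} {F : ι → α → ℝ} {f : α → ℝ}
    {s : Set α} (h : TendstoUniformlyOn F f l s) (c : ℝ) :
    TendstoUniformlyOn (fun i x => c * F i x) (fun x => c * f x) l s :=
  (Real.uniformContinuous_const_mul (x := c)).comp_tendstoUniformlyOn h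

theorem continuousOn_setIntegral_sq (hΩ : IsOpen Ω) (hb : Bornology.IsBounded Ω) {I : Set ℝ}
    (hI : IsCompact I)
    (hw : ContinuousOn (fun p : ℝ × Euc n => w p.1 p.2) (I ×ˢ closure Ω)) :
    ContinuousOn (fun t => ∫ x in Ω, w t x ^ 2) I := by
  obtain ⟨M, hM⟩ := exists_bound_on_prod_closure (f := fun t x => w t x ^ 2) hb hI (hw.pow 2)
  refine continuousOn_of_dominated (bound := fun _ => M) (fun t ht => ?_) (fun t ht => ?_)
    (integrableOn_const hb.measure_lt_top.ne) ?_
  · exact (((continuousOn_slice hw ht).mono subset_closure).pow 2).aestronglyMeasurable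
      hΩ.measurableSet
  · exact (ae_restrict_iff' hΩ.measurableSet).2
      (ae_of_all _ fun x hx => hM t ht x (subset_closure hx))
  · refine (ae_restrict_iff' hΩ.measurableSet).2 (ae_of_all _ fun x hx => ?_)
    exact (hw.comp (f := fun t => (t, x)) (by fun_prop)
      fun t ht => ⟨ht, subset_closure hx⟩).pow 2

theorem IsClassicalNeumann.continuousOn_slice (hw : IsClassicalNeumann Ω w) {t : ℝ} (ht : 0 ≤ t) :
    ContinuousOn (w t) (closure Ω) :=
  _root_.continuousOn_slice hw.continuousOn (mem_Ici.2 ht)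

theorem IsClassicalNeumann.integrableOn_sq (hw : IsClassicalNeumann Ω w)
    (hb : Bornology.IsBounded Ω) {t : ℝ} (ht : 0 ≤ t) :
    IntegrableOn (fun x => w t x ^ 2) Ω :=
  (((hw.continuousOn_slice ht).pow 2).integrableOn_compact hb.isCompact_closure).mono_set
    subset_closure

theorem IsClassicalNeumann.continuousOn_deriv (hw : IsClassicalNeumann Ω w) {t : ℝ} (ht : 0 < t) :
    ContinuousOn (fun x => deriv (fun s => w s x) t) Ω :=
  _root_.continuousOn_slice (f := fun t x => deriv (fun s => w s x) t) hw.continuousOn_time_deriv ht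

/-- The time derivative may blow up near the boundary or as time tends to `0`. On the compact set
`[t/2, t+1] × tsupport χ` it is bounded, which gives the dominating constant. -/
theorem IsClassicalNeumann.hasDerivAt_setIntegral_mul_sq (hw : IsClassicalNeumann Ω w)
    (hΩ : IsOpen Ω) (hb : Bornology.IsBounded Ω) {χ : Euc n → ℝ} (hχ : Continuous χ)
    (hc : HasCompactSupport χ) (hs : tsupport χ ⊆ Ω) {t : ℝ} (ht : 0 < t) :
    HasDerivAt (fun s => ∫ x in Ω, χ x * w s x ^ 2)
      (∫ x in Ω, χ x * (2 * w t x * deriv (fun s => w s x) t)) t := by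
  have hpos : ∀ s ∈ Icc (t / 2) (t + 1), 0 < s := fun s hs => by linarith [hs.1]
  have hwt : ∀ s, 0 ≤ s → ContinuousOn (fun x => w s x ^ 2) Ω := fun s hs' =>
    ((hw.continuousOn_slice hs').mono subset_closure).pow 2
  have hcont : ContinuousOn (fun p : ℝ × Euc n =>
      χ p.2 * (2 * w p.1 p.2 * deriv (fun s => w s p.2) p.1))
      (Icc (t / 2) (t + 1) ×ˢ tsupport χ) := by
    refine (hχ.comp continuous_snd).continuousOn.mul ((continuousOn_const.mul ?_).mul ?_)
    · exact hw.continuousOn.mono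
        (prod_mono (fun s hs' => (hpos s hs').le) (hs.trans subset_closure))
    · exact hw.continuousOn_time_deriv.mono (prod_mono (fun s hs' => hpos s hs') hs)
  obtain ⟨M, hM⟩ := (isCompact_Icc.prod hc).exists_bound_of_continuousOn hcont
  refine (hasDerivAt_integral_of_dominated_loc_of_deriv_le (bound := fun _ => |M|)
    (s := Icc (t / 2) (t + 1)) (F := fun s x => χ x * w s x ^ 2)
    (F' := fun s x => χ x * (2 * w s x * deriv (fun s => w s x) s))
    (Icc_mem_nhds (by linarith) (by linarith)) ?_ ?_ ?_ ?_
    (integrableOn_const hb.measure_lt_top.ne) ?_).2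
  · filter_upwards [lt_mem_nhds ht] with s hs'
    exact (continuous_mul_of_tsupport_subset hΩ hχ.continuousOn hs
      (hwt s hs'.le)).aestronglyMeasurable
  · exact (integrable_mul_of_tsupport_subset hΩ hχ.continuousOn hc hs (hwt t ht.le)).integrableOn
  · exact (continuous_mul_of_tsupport_subset hΩ hχ.continuousOn hs
      ((continuousOn_const.mul ((hw.continuousOn_slice ht.le).mono subset_closure)).mul
        (hw.continuousOn_deriv ht))).aestronglyMeasurable
  · refine ae_of_all _ fun x s hs' => ?_
    by_cases hx : x ∈ tsupport χ
    · exact (hM (s, x) ⟨hs', hx⟩).trans (le_abs_self M)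
    · simp [image_eq_zero_of_notMem_tsupport hx]
  · refine (ae_restrict_iff' hΩ.measurableSet).2 (ae_of_all _ fun x hx s hs' => ?_)
    have := ((hw.differentiableAt_time s (hpos s hs') x hx).hasDerivAt.pow 2).const_mul (χ x)
    simpa [mul_assoc] using this

/-- Green's identity with test function `χ_m u`. The layer term is written with `G` so that its
integrand is continuous up to the boundary. -/
theorem setIntegral_sublevelCutoff_mul_mul_laplacian (h : IsDefiningFunction Ω ρ) (hΩ : IsOpen Ω)
    (hb : Bornology.IsBounded Ω) {u : Euc n → ℝ} (hu : ContDiffOn ℝ 2 u Ω)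
    (huc : ContinuousOn u (closure Ω)) {G : Euc n → Euc n} (hG : HasNeumannGradient Ω u G)
    (m : ℕ) :
    ∫ x in Ω, sublevelCutoff ρ m x * (u x * Δ u x)
      = (∫ x in Ω, sublevelCutoffSlope ρ m x * (u x * inner ℝ (∇ ρ x) (G x)))
        - ∫ x in Ω, sublevelCutoff ρ m x * ‖∇ u x‖ ^ 2 := by
  have hχ := contDiff_sublevelCutoff h.smooth m
  have hs := h.tsupport_sublevelCutoff_subset m
  have hc := h.hasCompactSupport_sublevelCutoff hb m
  have hu1 : ContDiffOn ℝ 1 u Ω := hu.of_le (by norm_num)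
  have hρd : Differentiable ℝ ρ := h.smooth.differentiable (by simp)
  have hgreen := setIntegral_mul_laplacian_of_tsupport_subset (φ := fun x => sublevelCutoff ρ m x * u x)
    hΩ (hχ.contDiffOn.mul hu1) hc.mul_right ((tsupport_mul_subset_left).trans hs) hu
  have hgrad : ∀ x ∈ Ω, inner ℝ (∇ (fun x => sublevelCutoff ρ m x * u x) x) (∇ u x)
      = sublevelCutoff ρ m x * ‖∇ u x‖ ^ 2
        - sublevelCutoffSlope ρ m x * (u x * inner ℝ (∇ ρ x) (G x)) := by
    intro x hx
    have hud : DifferentiableAt ℝ u x :=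
      (hu1.contDiffAt (hΩ.mem_nhds hx)).differentiableAt one_ne_zero
    have hχd : DifferentiableAt ℝ (sublevelCutoff ρ m) x := hχ.differentiable one_ne_zero x
    have e1 : inner ℝ (∇ (sublevelCutoff ρ m) x) (∇ u x)
        = -(sublevelCutoffSlope ρ m x * inner ℝ (∇ ρ x) (∇ u x)) := by
      rw [gradient_sublevelCutoff hρd, inner_smul_left]; simp
    rw [inner_gradient_left] at e1
    rw [hG.eq_gradient x hx, inner_gradient_left, fderiv_fun_mul hχd hud]
    simp only [add_apply, smul_apply, smul_eq_mul]
    rw [e1, ← inner_gradient_left, real_inner_self_eq_norm_sq]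
    ring
  have hnorm : ContinuousOn (fun x => ‖∇ u x‖ ^ 2) Ω :=
    ((hG.continuousOn.mono subset_closure).congr fun x hx => (hG.eq_gradient x hx).symm).norm.pow 2
  rw [setIntegral_congr_fun hΩ.measurableSet hgrad, integral_sub] at hgreen
  · rw [← neg_sub, ← hgreen]
    simp_rw [mul_assoc]
  · exact (integrable_mul_of_tsupport_subset hΩ hχ.continuous.continuousOn hc hs hnorm).integrableOn
  · exact h.integrableOn_sublevelCutoffSlope_mul hb m
      (huc.mul (h.continuous_gradient.continuousOn.inner hG.continuousOn))

theorem IsClassicalNeumann.tendstoUniformlyOn_setIntegral_mul_laplacian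
    (hw : IsClassicalNeumann Ω w) (h : IsDefiningFunction Ω ρ) (hΩ : IsOpen Ω)
    (hb : Bornology.IsBounded Ω) {I : Set ℝ} (hI : IsCompact I) (hpos : I ⊆ Ioi 0) :
    TendstoUniformlyOn (fun m t => ∫ x in Ω, sublevelCutoff ρ m x * (w t x * Δ (w t) x))
      (fun t => -∫ x in Ω, ‖∇ (w t) x‖ ^ 2) atTop I := by
  obtain ⟨G, hGc, hG⟩ := hw.neumann
  have hGI : ContinuousOn (fun p : ℝ × Euc n => G p.1 p.2) (I ×ˢ closure Ω) :=
    hGc.mono (prod_mono hpos subset_rfl)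
  have hwI : ContinuousOn (fun p : ℝ × Euc n => w p.1 p.2) (I ×ˢ closure Ω) :=
    hw.continuousOn.mono (prod_mono (hpos.trans Ioi_subset_Ici_self) subset_rfl)
  have h1 := h.tendstoUniformlyOn_setIntegral_sublevelCutoffSlope_mul hΩ hb hI
    (f := fun t x => w t x * inner ℝ (∇ ρ x) (G t x))
    (hwI.mul ((h.continuous_gradient.comp continuous_snd).continuousOn.inner hGI)) (by
      intro t ht x hx hx'
      -- The Neumann condition enters here: `∇ρ` is a positive multiple of the normal, so the layer
      -- integrand vanishes on the boundary.
      have hν : IsOuterUnitNormal Ω x (‖∇ ρ x‖⁻¹ • ∇ ρ x) :=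
        ⟨by rw [hΩ.frontier_eq]; exact ⟨hx, hx'⟩, ρ, h, rfl⟩
      have h2 := (hG t (hpos ht)).neumann x _ hν
      have h3 : ‖∇ ρ x‖ ≠ 0 := norm_ne_zero_iff.2 (h.regular x (h.eq_zero_of_mem_frontier hx hx'))
      rw [inner_smul_right, mul_eq_zero, or_iff_right (inv_ne_zero h3), real_inner_comm] at h2
      rw [h2, mul_zero])
  obtain ⟨M, hM⟩ := exists_bound_on_prod_closure (f := fun t x => ‖G t x‖ ^ 2) hb hI
    (hGI.norm.pow 2)
  have h2 := h.tendstoUniformlyOn_setIntegral_sublevelCutoff_mul hΩ hb (I := I)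
    (f := fun t x => ‖∇ (w t) x‖ ^ 2) (M := M)
    (fun t ht => (((hG t (hpos ht)).continuousOn.mono subset_closure).congr
      fun x hx => ((hG t (hpos ht)).eq_gradient x hx).symm).norm.pow 2)
    (fun t ht x hx => by
      rw [← (hG t (hpos ht)).eq_gradient x hx]; exact hM t ht x (subset_closure hx))
  refine ((h1.sub h2).congr (Eventually.of_forall fun m t ht => ?_)).congr_right fun t _ => ?_
  · exact (setIntegral_sublevelCutoff_mul_mul_laplacian h hΩ hb (hw.contDiffOn_space t (hpos ht))
      (hw.continuousOn_slice (le_of_lt (hpos ht))) (hG t (hpos ht)) m).symm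
  · simp

theorem IsClassicalNeumann.tendstoUniformlyOn_setIntegral_mul_sq
    (hw : IsClassicalNeumann Ω w) (h : IsDefiningFunction Ω ρ) (hΩ : IsOpen Ω)
    (hb : Bornology.IsBounded Ω) {I : Set ℝ} (hI : IsCompact I) (hpos : I ⊆ Ici 0) :
    TendstoUniformlyOn (fun m t => ∫ x in Ω, sublevelCutoff ρ m x * w t x ^ 2)
      (fun t => ∫ x in Ω, w t x ^ 2) atTop I := by
  obtain ⟨M, hM⟩ := exists_bound_on_prod_closure (f := fun t x => w t x ^ 2) hb hI
    ((hw.continuousOn.mono (prod_mono hpos subset_rfl)).pow 2)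
  exact h.tendstoUniformlyOn_setIntegral_sublevelCutoff_mul hΩ hb
    (fun t ht => ((hw.continuousOn_slice (hpos ht)).mono subset_closure).pow 2)
    fun t ht x hx => hM t ht x (subset_closure hx)

end Energy

/-! ### Energy identity and decay for the error system. -/

section ErrorSystem

variable {n : ℕ} {Ω : Set (Euc n)} {d : Fin 3 → ℝ} {k : ℝ} {u₂ u₃ v₁ : ℝ → Euc n → ℝ}
  {E : ℝ → Euc n → Fin 3 → ℝ}

/-- The skew-symmetric part of the error matrix does not contribute to the quadratic form. -/
theorem sum_mul_errorMatrix_mulVec (k a b c : ℝ) (e : Fin 3 → ℝ) :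
    ∑ i, e i * (errorMatrix k a b c).mulVec e i
      = -(0.4 * e 0 ^ 2) - 0.4 * e 1 ^ 2 - k * e 2 ^ 2 := by
  simp [errorMatrix, Matrix.mulVec, dotProduct, Fin.sum_univ_three]
  ring

theorem IsErrorSolution.integral_sq_add (hE : IsErrorSolution Ω d k u₂ u₃ v₁ E)
    (hb : Bornology.IsBounded Ω) {t : ℝ} (ht : 0 ≤ t) :
    ∫ x in Ω, (E t x 0 ^ 2 + E t x 1 ^ 2 + E t x 2 ^ 2)
      = (∫ x in Ω, E t x 0 ^ 2) + (∫ x in Ω, E t x 1 ^ 2) + ∫ x in Ω, E t x 2 ^ 2 := by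
  have hi := fun i => (hE.regular i).integrableOn_sq hb ht
  exact (integral_add (Integrable.add (hi 0) (hi 1)) (hi 2)).trans
    (congrArg (· + ∫ x in Ω, E t x 2 ^ 2) (integral_add (hi 0) (hi 1)))

theorem IsErrorSolution.sum_setIntegral_mul_deriv (hE : IsErrorSolution Ω d k u₂ u₃ v₁ E)
    (hΩ : IsOpen Ω) {χ : Euc n → ℝ} (hχ : Continuous χ)
    (hc : HasCompactSupport χ) (hs : tsupport χ ⊆ Ω) {t : ℝ} (ht : 0 < t) :
    ∑ i, ∫ x in Ω, χ x * (E t x i * deriv (fun s => E s x i) t)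
      = (∑ i, d i * ∫ x in Ω, χ x * (E t x i * Δ (fun y => E t y i) x))
        - 0.4 * (∫ x in Ω, χ x * E t x 0 ^ 2) - 0.4 * (∫ x in Ω, χ x * E t x 1 ^ 2)
        - k * ∫ x in Ω, χ x * E t x 2 ^ 2 := by
  have hcE : ∀ i, ContinuousOn (fun x => E t x i) Ω := fun i =>
    ((hE.regular i).continuousOn_slice ht.le).mono subset_closure
  have hint : ∀ {f : Euc n → ℝ}, ContinuousOn f Ω → IntegrableOn (fun x => χ x * f x) Ω :=
    fun hf => (integrable_mul_of_tsupport_subset hΩ hχ.continuousOn hc hs hf).integrableOn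
  have h1 : ∀ i, IntegrableOn (fun x => χ x * (E t x i * deriv (fun s => E s x i) t)) Ω :=
    fun i => hint ((hcE i).mul ((hE.regular i).continuousOn_deriv ht))
  have h2 : ∀ i, IntegrableOn (fun x => χ x * (E t x i * Δ (fun y => E t y i) x)) Ω :=
    fun i => hint ((hcE i).mul (((hE.regular i).contDiffOn_space t ht).continuousOn_laplacian hΩ))
  have h3 : ∀ i, IntegrableOn (fun x => χ x * E t x i ^ 2) Ω := fun i => hint ((hcE i).pow 2)
  have h4 : IntegrableOn (fun x => ∑ i, d i * (χ x * (E t x i * Δ (fun y => E t y i) x))) Ω :=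
    integrable_finsetSum _ fun i _ => Integrable.const_mul (h2 i) (d i)
  have h5 : IntegrableOn (fun x => (∑ i, d i * (χ x * (E t x i * Δ (fun y => E t y i) x)))
      - 0.4 * (χ x * E t x 0 ^ 2)) Ω := Integrable.sub h4 (Integrable.const_mul (h3 0) _)
  have h6 : IntegrableOn (fun x => (∑ i, d i * (χ x * (E t x i * Δ (fun y => E t y i) x)))
      - 0.4 * (χ x * E t x 0 ^ 2) - 0.4 * (χ x * E t x 1 ^ 2)) Ω :=
    Integrable.sub h5 (Integrable.const_mul (h3 1) _)
  simp_rw [← integral_const_mul]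
  rw [← integral_finsetSum _ fun i _ => h1 i,
    ← integral_finsetSum _ fun i _ => Integrable.const_mul (h2 i) (d i),
    ← integral_sub h4 (Integrable.const_mul (h3 0) _),
    ← integral_sub h5 (Integrable.const_mul (h3 1) _),
    ← integral_sub h6 (Integrable.const_mul (h3 2) _)]
  refine setIntegral_congr_fun hΩ.measurableSet fun x hx => ?_
  have hq := sum_mul_errorMatrix_mulVec k (u₂ t x) (u₃ t x) (v₁ t x) (E t x)
  simp_rw [← hE.equation t ht x hx] at hq
  simp only [Fin.sum_univ_three] at hq ⊢
  linear_combination χ x * hq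

theorem IsErrorSolution.hasDerivAt_energy (hE : IsErrorSolution Ω d k u₂ u₃ v₁ E)
    (hΩ : IsSmoothBoundedDomain Ω) {t : ℝ} (ht : 0 < t) :
    HasDerivAt (fun s => energy Ω (E s))
        (-(∑ i, d i * ∫ x in Ω, ‖∇ (fun y => E t y i) x‖ ^ 2)
          - 0.4 * (∫ x in Ω, E t x 0 ^ 2) - 0.4 * (∫ x in Ω, E t x 1 ^ 2)
          - k * ∫ x in Ω, E t x 2 ^ 2) t := by
  obtain ⟨ρ, h⟩ := hΩ.smooth_boundary
  have hpos : Icc (t / 2) (t + 1) ⊆ Ioi 0 := fun s hs => by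
    have := hs.1
    simp only [mem_Ioi]
    linarith
  have hpos' : Icc (t / 2) (t + 1) ⊆ Ici 0 := hpos.trans Ioi_subset_Ici_self
  have hL := fun i => ((hE.regular i).tendstoUniformlyOn_setIntegral_mul_laplacian h hΩ.isOpen
    hΩ.bounded isCompact_Icc hpos).const_mul_real (d i)
  have hS := fun i => (hE.regular i).tendstoUniformlyOn_setIntegral_mul_sq h hΩ.isOpen
    hΩ.bounded isCompact_Icc hpos'
  have hlim := (((((hL 0).add (hL 1)).add (hL 2)).sub ((hS 0).const_mul_real 0.4)).sub
    ((hS 1).const_mul_real 0.4)).sub ((hS 2).const_mul_real k)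
  -- Derivative of a limit: the cut-off energies converge pointwise and their derivatives uniformly
  -- near `t`.
  have hderiv := hasDerivAt_of_tendstoUniformlyOn (s := Ioo (t / 2) (t + 1)) isOpen_Ioo
    (hlim.mono Ioo_subset_Icc_self)
    (f := fun m s => ∑ i, 1 / 2 * ∫ x in Ω, sublevelCutoff ρ m x * E s x i ^ 2)
    (g := fun s => energy Ω (E s)) (x := t) (Eventually.of_forall fun m s hs => ?_)
    (fun s hs => ?_) ⟨by linarith, by linarith⟩
  · refine hderiv.congr_deriv ?_
    simp only [Fin.sum_univ_three, Pi.add_apply, Pi.sub_apply]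
    ring
  · have hs0 : 0 < s := hpos (Ioo_subset_Icc_self hs)
    have hχ := (contDiff_sublevelCutoff h.smooth m).continuous
    have hc := h.hasCompactSupport_sublevelCutoff hΩ.bounded m
    have hsupp := h.tsupport_sublevelCutoff_subset m
    have h1 := HasDerivAt.fun_sum fun i (_ : i ∈ Finset.univ) =>
      ((hE.regular i).hasDerivAt_setIntegral_mul_sq hΩ.isOpen hΩ.bounded hχ hc hsupp
        hs0).const_mul (1 / 2)
    refine h1.congr_deriv ?_
    have h2 := hE.sum_setIntegral_mul_deriv hΩ.isOpen hχ hc hsupp hs0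
    rw [Fin.sum_univ_three (fun i => d i * _)] at h2
    refine Eq.trans (Finset.sum_congr rfl fun i _ => ?_) h2
    rw [← integral_const_mul]
    congr 1 with x
    ring
  · have hs' := Ioo_subset_Icc_self hs
    have h1 : energy Ω (E s) = ∑ i, 1 / 2 * ∫ x in Ω, E s x i ^ 2 := by
      rw [energy, hE.integral_sq_add hΩ.bounded (hpos' hs'), Fin.sum_univ_three]
      ring
    simp only [h1]
    exact tendsto_finsetSum _ fun i _ => ((hS i).tendsto_at hs').const_mul _

theorem IsErrorSolution.continuousOn_energy (hE : IsErrorSolution Ω d k u₂ u₃ v₁ E)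
    (hΩ : IsSmoothBoundedDomain Ω) : ContinuousOn (fun t => energy Ω (E t)) (Ici 0) := by
  have hIcc : ContinuousOn (fun t => energy Ω (E t)) (Icc 0 1) := by
    have h1 := fun i => continuousOn_setIntegral_sq (w := fun t x => E t x i) hΩ.isOpen hΩ.bounded isCompact_Icc
      ((hE.regular i).continuousOn.mono
        (prod_mono (Icc_subset_Ici_self : Icc (0 : ℝ) 1 ⊆ Ici 0) subset_rfl))
    refine (continuousOn_const (c := (1 / 2 : ℝ))).mul
      ((((h1 0).add (h1 1)).add (h1 2)).congr fun t ht => ?_)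
    exact hE.integral_sq_add hΩ.bounded ht.1
  intro t ht
  -- The energy identity covers only positive times; at `0` continuity comes from dominated
  -- convergence on `[0,1]`.
  rcases (mem_Ici.1 ht).eq_or_lt with rfl | hpos
  · exact (hIcc 0 ⟨le_rfl, zero_le_one⟩).mono_of_mem_nhdsWithin
      (Icc_mem_nhdsGE zero_lt_one)
  · exact (hE.hasDerivAt_energy hΩ hpos).continuousAt.continuousWithinAt

/-- Grönwall: `exp (2ct) V(t)` is nonincreasing, since `2cV = c ∑ ∫ e_i²` is absorbed by the damping
and the gradient terms have a good sign. -/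
theorem IsErrorSolution.energy_le (hE : IsErrorSolution Ω d k u₂ u₃ v₁ E)
    (hΩ : IsSmoothBoundedDomain Ω) (hd : ∀ i, 0 < d i) {c : ℝ} (hc : c ≤ 0.4) (hck : c ≤ k)
    {t : ℝ} (ht : 0 ≤ t) :
    energy Ω (E t) ≤ Real.exp (-(2 * c) * t) * energy Ω (E 0) := by
  have hexp : ∀ s : ℝ, HasDerivAt (fun s => Real.exp (2 * c * s)) (Real.exp (2 * c * s) * (2 * c)) s :=
    fun s => by simpa using ((hasDerivAt_id s).const_mul (2 * c)).exp
  have hderiv := fun (s : ℝ) (hs : 0 < s) => (hexp s).fun_mul (hE.hasDerivAt_energy hΩ hs)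
  have hanti : AntitoneOn (fun s => Real.exp (2 * c * s) * energy Ω (E s)) (Ici 0) := by
    refine antitoneOn_of_deriv_nonpos (convex_Ici 0)
      ((by fun_prop : Continuous fun s : ℝ => Real.exp (2 * c * s)).continuousOn.mul
        (hE.continuousOn_energy hΩ)) ?_ ?_
    · rw [interior_Ici]
      exact fun s hs => (hderiv s hs).differentiableAt.differentiableWithinAt
    · rw [interior_Ici]
      intro s hs
      rw [(hderiv s hs).deriv, energy, hE.integral_sq_add hΩ.bounded (le_of_lt hs)]
      have hg : 0 ≤ ∑ i, d i * ∫ x in Ω, ‖∇ (fun y => E s y i) x‖ ^ 2 :=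
        Finset.sum_nonneg fun i _ => mul_nonneg (hd i).le
          (integral_nonneg fun x => by positivity)
      have hn : ∀ i, 0 ≤ ∫ x in Ω, E s x i ^ 2 := fun i => integral_nonneg fun x => by positivity
      rw [mul_assoc, ← mul_add]
      refine mul_nonpos_of_nonneg_of_nonpos (Real.exp_pos _).le ?_
      nlinarith [mul_nonneg (sub_nonneg.2 hc) (hn 0), mul_nonneg (sub_nonneg.2 hc) (hn 1),
        mul_nonneg (sub_nonneg.2 hck) (hn 2)]
  have h0 : Real.exp (2 * c * t) * energy Ω (E t) ≤ energy Ω (E 0) := by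
    simpa using hanti (mem_Ici.2 le_rfl) (mem_Ici.2 ht) ht
  calc energy Ω (E t)
      = Real.exp (-(2 * c) * t) * (Real.exp (2 * c * t) * energy Ω (E t)) := by
        rw [← mul_assoc, ← Real.exp_add]; simp
    _ ≤ _ := mul_le_mul_of_nonneg_left h0 (Real.exp_pos _).le

theorem l2Norm_eq_sqrt_energy (w : Euc n → Fin 3 → ℝ) :
    l2Norm Ω w = Real.sqrt (2 * energy Ω w) := by
  rw [l2Norm, energy]; congr 1; ring

theorem IsErrorSolution.l2Norm_le (hE : IsErrorSolution Ω d k u₂ u₃ v₁ E)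
    (hΩ : IsSmoothBoundedDomain Ω) (hd : ∀ i, 0 < d i) {c : ℝ} (hc : c ≤ 0.4) (hck : c ≤ k)
    {t : ℝ} (ht : 0 ≤ t) :
    l2Norm Ω (E t) ≤ Real.exp (-c * t) * l2Norm Ω (E 0) := by
  rw [l2Norm_eq_sqrt_energy, l2Norm_eq_sqrt_energy]
  have h1 : Real.exp (-c * t) = Real.sqrt (Real.exp (-(2 * c) * t)) := by
    rw [← Real.exp_half]; ring_nf
  rw [h1, ← Real.sqrt_mul (Real.exp_pos _).le]
  refine Real.sqrt_le_sqrt ?_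
  linarith [hE.energy_le hΩ hd hc hck ht]

theorem isClassicalNeumann_zero : IsClassicalNeumann Ω (fun _ _ => 0) where
  continuousOn := continuousOn_const
  differentiableAt_time := fun _ _ _ _ => differentiableAt_const _
  continuousOn_time_deriv := by simpa using continuousOn_const
  contDiffOn_space := fun _ _ => contDiffOn_const
  continuousOn_space_deriv := by
    rw [iteratedFDeriv_fun_zero]
    exact continuousOn_const
  neumann := ⟨fun _ _ => 0, continuousOn_const, fun _ _ =>
    ⟨continuousOn_const, fun x _ => (gradient_fun_const x 0).symm, fun _ _ _ => inner_zero_left _⟩⟩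

theorem zero_mem_errorSolutions : (fun _ _ _ => 0) ∈ errorSolutions Ω d k u₂ u₃ := by
  refine ⟨fun _ _ => 0, fun _ => isClassicalNeumann_zero, fun t _ x _ i => ?_⟩
  have h1 : Δ (fun _ : Euc n => (0 : ℝ)) x = 0 := by
    simp [InnerProductSpace.laplacian_const]
  have h2 : (fun _ : Fin 3 => (0 : ℝ)) = 0 := rfl
  rw [h1, h2, Matrix.mulVec_zero]
  simp

end ErrorSystem

theorem theorem2 {n : ℕ} (hn : 1 ≤ n) (Ω : Set (Euc n)) (hΩ : IsSmoothBoundedDomain Ω)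
    (d : Fin 3 → ℝ) (hd : ∀ i, 0 < d i) (k : ℝ) (hk : 0 < k) (u₂ u₃ : ℝ → Euc n → ℝ)
    (hcond : ∀ t > 0, ∀ x ∈ Ω,
      (0.52 + 100 * u₃ t x ^ 2 + 20 * u₃ t x) / (1.6 + 2 * k)
        < d 2 * firstNeumannEigenvalue Ω) :
    ZeroGloballyAsymptoticallyStable Ω (errorSolutions Ω d k u₂ u₃) ∧
    (∃ C > 0, ∃ c > 0, ∀ E ∈ errorSolutions Ω d k u₂ u₃, ∀ t ≥ 0,
      l2Norm Ω (E t) ≤ C * Real.exp (-c * t) * l2Norm Ω (E 0)) ∧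
    (∀ E ∈ errorSolutions Ω d k u₂ u₃, ∀ t > 0,
      HasDerivAt (fun s => energy Ω (E s))
        (-(∑ i, d i * ∫ x in Ω, ‖∇ (fun y => E t y i) x‖ ^ 2)
          - 0.4 * (∫ x in Ω, E t x 0 ^ 2) - 0.4 * (∫ x in Ω, E t x 1 ^ 2)
          - k * ∫ x in Ω, E t x 2 ^ 2) t) := by
  -- The slowest damping rate on the diagonal.
  have hc : (0 : ℝ) < min 0.4 k := lt_min (by norm_num) hk
  have hdecay : ∀ E ∈ errorSolutions Ω d k u₂ u₃, ∀ t ≥ 0,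
      l2Norm Ω (E t) ≤ Real.exp (-(min 0.4 k) * t) * l2Norm Ω (E 0) :=
    fun E ⟨_, hE⟩ t ht => hE.l2Norm_le hΩ hd (min_le_left _ _) (min_le_right _ _) ht
  -- The decay estimate has constant `1`, so the norm never exceeds its initial value and `δ = ε`
  -- works.
  refine ⟨⟨zero_mem_errorSolutions, fun ε hε => ⟨ε, hε, fun E hE h0 t ht => ?_⟩, fun E hE => ?_⟩,
    ⟨1, one_pos, _, hc, fun E hE t ht => by simpa using hdecay E hE t ht⟩,
    fun E ⟨_, hE⟩ t ht => hE.hasDerivAt_energy hΩ ht⟩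
  · have h1 : Real.exp (-(min 0.4 k) * t) ≤ 1 := Real.exp_le_one_iff.2 (by nlinarith)
    have h2 : 0 ≤ l2Norm Ω (E 0) := Real.sqrt_nonneg _
    nlinarith [hdecay E hE t ht]
  · have h1 : Tendsto (fun t : ℝ => Real.exp (-(min 0.4 k) * t)) atTop (𝓝 0) :=
      Real.tendsto_exp_atBot.comp (tendsto_id.const_mul_atTop_of_neg (neg_neg_of_pos hc))
    have h2 := h1.mul_const (l2Norm Ω (E 0))
    rw [zero_mul] at h2
    refine tendsto_of_tendsto_of_tendsto_of_le_of_le' tendsto_const_nhds h2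
      (Eventually.of_forall fun t => Real.sqrt_nonneg _) ?_
    filter_upwards [eventually_ge_atTop 0] with t ht using hdecay E hE t ht
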